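/- Let $\mathbb{K}\in\{\mathbb{R},\mathbb{C}\}$, let $d\ge 1$ and let $\Omega\subseteq\mathbb{R}^d$ be a non-empty open set (for example $\Omega=\mathbb{R}^d$). Let $\mathscr{D}=\mathscr{D}(\Omega)$ be the space of smooth $\mathbb{K}$-valued functions with compact support in $\Omega$, with its canonical LF (locally convex inductive limit) topology, and let $\mathscr{D}'=\mathscr{D}'(\Omega)$ be the space of distributions on $\Omega$, i.e. the space of continuous $\mathbb{K}$-linear functionals on $\mathscr{D}$, equipped with the strong topology (uniform convergence on bounded subsets of $\mathscr{D}$). A topological space $X$ is called hemicompact if there is an increasing sequence $(K_n)_{n\in\mathbb{N}}$ of compact subsets of $X$ such that every compact subset of $X$ is contained in some $K_n$. Proposition. The space of distributions $\mathscr{D}'$ is not hemicompact. -/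

import Mathlib

open TopologicalSpace
open scoped Distributions

/-- A topological space is hemicompact if there is an increasing sequence of compact subsets
such that every compact subset is contained in one of them. -/
def IsHemicompact (X : Type*) [TopologicalSpace X] : Prop :=
  ∃ K : ℕ → Set X, Monotone K ∧ (∀ n, IsCompact (K n)) ∧
    ∀ L : Set X, IsCompact L → ∃ n, L ⊆ K n

/-- The space of `𝕜`-valued distributions on an open set `Ω` of `ℝᵈ`: the continuous `𝕜`-linear
functionals on the space `𝓓(Ω, 𝕜)` of smooth compactly supported functions with its canonical
LF topology. As a topological space it carries the strong topology, that is, uniform convergence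
on the (von Neumann) bounded subsets of `𝓓(Ω, 𝕜)`. -/
abbrev DistributionSpace (𝕜 : Type*) [RCLike 𝕜] {d : ℕ}
    (Ω : Opens (EuclideanSpace ℝ (Fin d))) : Type _ :=
  StrongDual 𝕜 𝓓(Ω, 𝕜)

open Filter Topology Bornology
open scoped BoundedContinuousFunction

namespace TestFunction

variable {𝕜 E : Type*} [RCLike 𝕜] [NormedAddCommGroup E] [NormedSpace ℝ E] {Ω : Opens E}

/-! A diagonal argument. Take points `x n` leaving every compact subset of `Ω` and test functions
with `f n (x n) = 1`. Evaluation at `f n` is bounded on the compact set `K n`, so a large enough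
multiple of the point evaluation at `x n` lies outside `K n`. Yet such multiples tend strongly to
zero whatever the weights (`tendsto_smul_evalCLM`), so together with 0 they form a compact set
contained in no `K n`. -/

theorem isVonNBounded_singleton (f : 𝓓(Ω, 𝕜)) : IsVonNBounded 𝕜 ({f} : Set 𝓓(Ω, 𝕜)) := by
  let K : Compacts E := ⟨tsupport f, f.hasCompactSupport⟩
  let g : 𝓓_{K}(E, 𝕜) := .of_support_subset f.contDiff subset_closure
  have hg : ofSupportedInCLM 𝕜 (K := K) f.tsupport_subset g = f := rfl
  have h := (Bornology.isVonNBounded_singleton (𝕜 := 𝕜) g).image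
    (ofSupportedInCLM 𝕜 (K := K) (Ω := Ω) f.tsupport_subset)
  rwa [Set.image_singleton, hg] at h

/-- Evaluation of distributions at a test function is strongly continuous. -/
theorem continuous_strongDual_eval (f : 𝓓(Ω, 𝕜)) :
    Continuous fun T : StrongDual 𝕜 𝓓(Ω, 𝕜) ↦ T f :=
  (UniformConvergenceCLM.continuousEvalConst (RingHom.id 𝕜) 𝕜
    {S : Set 𝓓(Ω, 𝕜) | IsVonNBounded 𝕜 S} (Set.sUnion_eq_univ_iff.2 fun g ↦
      ⟨{g}, isVonNBounded_singleton g, rfl⟩)).continuous_eval_const f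

/-- Evaluation at a point, as a continuous linear functional on test functions. -/
noncomputable def evalCLM (x : E) : StrongDual 𝕜 𝓓(Ω, 𝕜) where
  toFun f := f x
  map_add' _ _ := rfl
  map_smul' _ _ := rfl
  cont := continuous_eval_const _

@[simp]
theorem evalCLM_apply (x : E) (f : 𝓓(Ω, 𝕜)) : evalCLM x f = f x := rfl

/-- The indicator of a natural number, as a bounded sequence. -/
noncomputable def singleSeq (𝕜 : Type*) [RCLike 𝕜] (n : ℕ) : ℕ →ᵇ 𝕜 :=
  .ofNormedAddCommGroupDiscrete (Pi.single n 1) 1 fun m ↦ by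
    by_cases h : m = n
    · subst h; simp
    · simp [h]

theorem finite_support_eval {x : ℕ → E}
    (hx : ∀ K : Set E, IsCompact K → K ⊆ Ω → {n | x n ∈ K}.Finite) (a : ℕ → 𝕜) (f : 𝓓(Ω, 𝕜)) :
    (Function.support fun n ↦ a n * f (x n)).Finite :=
  (hx _ f.hasCompactSupport f.tsupport_subset).subset fun _ hn ↦
    subset_tsupport f (right_ne_zero_of_mul hn)

/-- The weighted evaluation `f ↦ (a n * f (x n))ₙ` along a sequence of points of which every compact
subset of `Ω` contains only finitely many terms, as a continuous linear map to bounded sequences. -/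
theorem exists_weightedEvalCLM {x : ℕ → E}
    (hx : ∀ K : Set E, IsCompact K → K ⊆ Ω → {n | x n ∈ K}.Finite) (a : ℕ → 𝕜) :
    ∃ Φ : 𝓓(Ω, 𝕜) →L[𝕜] (ℕ →ᵇ 𝕜), ∀ f n, Φ f n = a n * f (x n) := by
  have hbdd (f : 𝓓(Ω, 𝕜)) : ∃ C, ∀ n, ‖a n * f (x n)‖ ≤ C := by
    have hfin : (Set.range fun n ↦ a n * f (x n)).Finite :=
      ((finite_support_eval hx a f).image _ |>.insert 0).subset <| by
        rintro _ ⟨n, rfl⟩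
        by_cases h : a n * f (x n) = 0
        · exact Or.inl h
        · exact Or.inr ⟨n, h, rfl⟩
    obtain ⟨C, hC⟩ := hfin.isBounded.exists_norm_le
    exact ⟨C, fun n ↦ hC _ ⟨n, rfl⟩⟩
  choose C hC using hbdd
  refine ⟨TestFunction.mkCLM 𝕜
    (fun f ↦ .ofNormedAddCommGroupDiscrete (fun n ↦ a n * f (x n)) (C f) (hC f))
    (fun f g ↦ ?_) (fun c f ↦ ?_) (fun K hK ↦ ?_), fun f n ↦ rfl⟩
  · ext n
    exact mul_add (a n) (f (x n)) (g (x n))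
  · ext n
    exact mul_left_comm (a n) c (f (x n))
  · have hS := hx K K.isCompact hK
    -- Continuity need only be checked on each `𝓓_{K}`, where only the finitely many `n` with `x n ∈
    -- K` contribute.
    have hcont : Continuous fun f : 𝓓_{K}(E, 𝕜) ↦
        ∑ n ∈ hS.toFinset, (a n * f (x n)) • singleSeq 𝕜 n :=
      continuous_finsetSum _ fun n _ ↦ by
        have h : Continuous fun f : 𝓓_{K}(E, 𝕜) ↦ f (x n) := continuous_eval_const (x n)
        fun_prop
    refine hcont.congr fun f ↦ ?_
    ext m
    have hval (n : ℕ) : singleSeq 𝕜 n m = if m = n then 1 else 0 := Pi.single_apply n 1 m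
    have hzero (h : x m ∉ K) : f (x m) = 0 := f.zero_on_compl h
    simp only [BoundedContinuousFunction.coe_sum, Finset.sum_apply,
      BoundedContinuousFunction.coe_smul, hval, smul_eq_mul, mul_ite, mul_one, mul_zero,
      Finset.sum_ite_eq]
    split_ifs with h
    · rfl
    · exact ((congrArg (a m * ·) (hzero fun hm ↦ h (hS.mem_toFinset.2 hm))).trans (mul_zero (a m))).symm

/-- Arbitrary multiples of evaluations along a sequence of points leaving every compact subset
of `Ω` converge strongly to zero. -/
theorem tendsto_smul_evalCLM {x : ℕ → E}
    (hx : ∀ K : Set E, IsCompact K → K ⊆ Ω → {n | x n ∈ K}.Finite) (c : ℕ → 𝕜) :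
    Tendsto (fun n ↦ c n • (evalCLM (x n) : StrongDual 𝕜 𝓓(Ω, 𝕜))) atTop (𝓝 0) := by
  -- The extra weight `n + 1` turns boundedness of `Φ` on `B` into decay like `M / (n + 1)`,
  -- uniformly on `B`.
  obtain ⟨Φ, hΦ⟩ := exists_weightedEvalCLM hx fun n ↦ ((n : 𝕜) + 1) * c n
  refine (ContinuousLinearMap.hasBasis_nhds_zero_of_basis
    Metric.nhds_basis_ball).tendsto_right_iff.2 ?_
  rintro ⟨B, ε⟩ ⟨hB, hε⟩
  obtain ⟨M, hM⟩ := (NormedSpace.image_isVonNBounded_iff 𝕜).1 (hB.image Φ)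
  obtain ⟨N, hN⟩ := exists_nat_gt (M / ε)
  filter_upwards [eventually_ge_atTop N] with n hn f hf
  rw [mem_ball_zero_iff, smul_apply, evalCLM_apply, smul_eq_mul]
  have hle : ((n : ℝ) + 1) * ‖c n * f (x n)‖ ≤ M := by
    have h := ((Φ f).norm_coe_le_norm n).trans (hM f hf)
    rw [hΦ, mul_assoc, norm_mul] at h
    have hn' : ‖(n : 𝕜) + 1‖ = (n : ℝ) + 1 := by
      exact_mod_cast RCLike.norm_natCast (K := 𝕜) (n + 1)
    rwa [hn'] at h
  have hlt : M < ((n : ℝ) + 1) * ε := by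
    rw [div_lt_iff₀ hε] at hN
    have : (N : ℝ) ≤ n := Nat.cast_le.2 hn
    nlinarith
  exact lt_of_mul_lt_mul_left (hle.trans_lt hlt) (by positivity)

theorem exists_apply_eq_one [FiniteDimensional ℝ E] {x : E} (hx : x ∈ Ω) :
    ∃ f : 𝓓(Ω, 𝕜), f x = 1 := by
  obtain ⟨f, hfs, hfc, hf, -, hfx⟩ :=
    exists_contDiff_tsupport_subset (n := ⊤) (Ω.isOpen.mem_nhds hx)
  refine ⟨⟨fun y ↦ (f y : 𝕜), (RCLike.ofRealCLM (K := 𝕜)).contDiff.comp hf,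
    hfc.comp_left (g := ((↑) : ℝ → 𝕜)) RCLike.ofReal_zero,
    (tsupport_comp_subset (g := ((↑) : ℝ → 𝕜)) RCLike.ofReal_zero f).trans hfs⟩, ?_⟩
  change (f x : 𝕜) = 1
  rw [hfx, RCLike.ofReal_one]

end TestFunction

/-- A nonempty open subset of a nontrivial finite-dimensional space contains a sequence of which
every compact subset contains only finitely many terms. -/
theorem TopologicalSpace.Opens.exists_seq_finite_mem_isCompact {E : Type*} [NormedAddCommGroup E]
    [NormedSpace ℝ E] [FiniteDimensional ℝ E] [Nontrivial E] (Ω : Opens E)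
    (hΩ : (Ω : Set E).Nonempty) :
    ∃ x : ℕ → E, (∀ n, x n ∈ Ω) ∧
      ∀ K : Set E, IsCompact K → K ⊆ Ω → {n | x n ∈ K}.Finite := by
  have : ProperSpace E := FiniteDimensional.proper ℝ E
  have : NoncompactSpace E := NormedSpace.noncompactSpace ℝ E
  have : LocallyCompactSpace Ω := Ω.isOpen.locallyCompactSpace
  -- If compact, `Ω` would be clopen, hence the whole noncompact space.
  have hncpt : ¬ IsCompact (Set.univ : Set Ω) := fun h ↦ by
    have hc : IsCompact (Ω : Set E) := isCompact_iff_isCompact_univ.2 h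
    have huniv : (Ω : Set E) = Set.univ := IsClopen.eq_univ ⟨hc.isClosed, Ω.isOpen⟩ hΩ
    exact noncompact_univ E (huniv ▸ hc)
  let K : CompactExhaustion Ω := default
  have hex (n : ℕ) : ∃ y, y ∉ K n := by
    by_contra! h
    exact hncpt (Set.eq_univ_of_forall h ▸ K.isCompact n)
  choose y hy using hex
  refine ⟨fun n ↦ y n, fun n ↦ (y n).2, fun L hL hLΩ ↦ ?_⟩
  have hL' : IsCompact ((↑) ⁻¹' L : Set Ω) :=
    Topology.IsInducing.subtypeVal.isCompact_preimage_iff (by simpa using hLΩ) |>.2 hL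
  obtain ⟨N, hN⟩ := K.exists_superset_of_isCompact hL'
  refine (Set.finite_lt_nat N).subset fun n hn ↦ ?_
  by_contra h
  exact hy n (K.subset (not_lt.1 h) (hN hn))

theorem mainTheorem9 (𝕜 : Type*) [RCLike 𝕜] (d : ℕ) (hd : 1 ≤ d)
    (Ω : Opens (EuclideanSpace ℝ (Fin d))) (hΩ : (Ω : Set (EuclideanSpace ℝ (Fin d))).Nonempty) :
    ¬ IsHemicompact (DistributionSpace 𝕜 Ω) := by
  rintro ⟨K, -, hK, hcover⟩
  have : Nonempty (Fin d) := ⟨⟨0, hd⟩⟩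
  obtain ⟨x, hxΩ, hx⟩ := Ω.exists_seq_finite_mem_isCompact hΩ
  choose f hf using fun n ↦ TestFunction.exists_apply_eq_one (𝕜 := 𝕜) (hxΩ n)
  choose C hC using fun n ↦
    (hK n).exists_bound_of_continuousOn (TestFunction.continuous_strongDual_eval (f n)).continuousOn
  -- The factor makes `T n (f n)` exceed the bound `C n` valid on `K n`.
  let T (n : ℕ) : DistributionSpace 𝕜 Ω := ((|C n| + 1 : ℝ) : 𝕜) • TestFunction.evalCLM (x n)
  obtain ⟨n, hn⟩ := hcover _ (TestFunction.tendsto_smul_evalCLM hx _).isCompact_insert_range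
  have hT : ‖T n (f n)‖ ≤ C n := hC n _ (hn (Or.inr ⟨n, rfl⟩))
  have hval : T n (f n) = ((|C n| + 1 : ℝ) : 𝕜) := by
    change ((|C n| + 1 : ℝ) : 𝕜) * f n (x n) = _
    rw [hf, mul_one]
  rw [hval, RCLike.norm_ofReal, abs_of_nonneg (by positivity)] at hT
  linarith [le_abs_self (C n)]
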